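/- Let $\mathbb F$ be a field of characteristic $0$, let $n\ge 2$ be an integer, and let $L=\prod_{j\ge -1}L_j$ be a $\mathbb Z$-graded Lie superalgebra over $\mathbb F$ (a product of vector superspaces with $[L_i,L_j]\subseteq L_{i+j}$ and the bracket computed componentwise). Let $\mu\in L_{n-1}$ be an element which is homogeneous with respect to parity, and suppose that the pair $(L,\mu)$ is admissible, i.e. 1. $L$ is transitive: if $a\in L_j$ with $j\ge 0$ and $[a,L_{-1}]=0$, then $a=0$; 2. $L$ is generated by $L_{-1}$ and $\mu$ as a $\mathbb Z$-graded Lie superalgebra, i.e. the only subsuperalgebra of the form $\prod_{j\ge-1} M_j$ with $M_j\subseteq L_j$ which contains $L_{-1}$ and $\mu$ is $L$ itself; 3. $[\mu,L_0]=0$. Then $L=\bigoplus_{j=-1}^{n-1}L_j$, where $L_{n-1}=\mathbb F\mu$, the subspace $S:=\bigoplus_{j=-1}^{n-2}L_j$ is an ideal in $L$, and $L_j=(\operatorname{ad}L_{-1})^{n-j-1}\mu$ for $j=0,\ldots,n-1$. Here $(\operatorname{ad}L_{-1})^{k}\mu$ denotes the linear span of all elements $[a_1,[a_2,\ldots,[a_k,\mu]\ldots]]$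 with $a_1,\ldots,a_k\in L_{-1}$. -/

import Mathlib

/-- A Lie superalgebra structure on the vector space `L` over the field `F` (the usual axioms,
for `F` of characteristic different from `2` and `3`): a decomposition of `L` into an even part
`parity 0` and an odd part `parity 1`, and an even bilinear bracket that is super-skew-symmetric
and satisfies the super Jacobi identity. -/
structure LieSuperalgebra (F L : Type*) [Field F] [AddCommGroup L] [Module F L] where
  /-- The even (`0`) and the odd (`1`) subspace. -/
  parity : ZMod 2 → Submodule F L
  isCompl_parity : IsCompl (parity 0) (parity 1)
  /-- The bracket. -/
  bracket : L →ₗ[F] L →ₗ[F] L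
  bracket_mem : ∀ {α β : ZMod 2} {x y : L}, x ∈ parity α → y ∈ parity β →
    bracket x y ∈ parity (α + β)
  skew : ∀ {α β : ZMod 2} {x y : L}, x ∈ parity α → y ∈ parity β →
    bracket x y = -((-1 : F) ^ (α.val * β.val) • bracket y x)
  jacobi : ∀ {α β : ZMod 2} {x y : L} (z : L), x ∈ parity α → y ∈ parity β →
    bracket x (bracket y z) =
      bracket (bracket x y) z + (-1 : F) ^ (α.val * β.val) • bracket y (bracket x z)

namespace LieSuperalgebra

/-- A subsuperspace: a subspace spanned by its even and its odd elements. -/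
def IsSubsuperspace {F L : Type*} [Field F] [AddCommGroup L] [Module F L]
    (A : LieSuperalgebra F L) (M : Submodule F L) : Prop :=
  M = (M ⊓ A.parity 0) ⊔ (M ⊓ A.parity 1)

/-- A subsuperalgebra: a subsuperspace closed under the bracket. -/
def IsSubsuperalgebra {F L : Type*} [Field F] [AddCommGroup L] [Module F L]
    (A : LieSuperalgebra F L) (M : Submodule F L) : Prop :=
  A.IsSubsuperspace M ∧ ∀ x ∈ M, ∀ y ∈ M, A.bracket x y ∈ M

/-- An ideal: a subsuperspace stable under bracketing with the whole algebra. -/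
def IsIdeal {F L : Type*} [Field F] [AddCommGroup L] [Module F L]
    (A : LieSuperalgebra F L) (I : Submodule F L) : Prop :=
  A.IsSubsuperspace I ∧ ∀ x : L, ∀ y ∈ I, A.bracket x y ∈ I

/-- A `ℤ`-grading `L = ∏_{j ≥ -1} L_j` of a Lie superalgebra. The component `L_j` is `comp j`,
and `proj j : L → L_j` is the projection of the product to its `j`-th factor. -/
structure ZGrading {F L : Type*} [Field F] [AddCommGroup L] [Module F L]
    (A : LieSuperalgebra F L) where
  /-- The homogeneous component of degree `j`. -/
  comp : ℤ → Submodule F L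
  comp_eq_bot : ∀ j : ℤ, j < -1 → comp j = ⊥
  /-- The projection to the component of degree `j`. -/
  proj : (j : ℤ) → L →ₗ[F] comp j
  proj_of_mem : ∀ (i j : ℤ), ∀ x ∈ comp i, (proj j x : L) = if j = i then x else 0
  /-- `L` is the full product of its components. -/
  bijective : Function.Bijective (fun (x : L) (j : ℤ) => proj j x)
  /-- It is a product of superspaces. -/
  proj_parity : ∀ (α : ZMod 2), ∀ x ∈ A.parity α, ∀ j : ℤ, (proj j x : L) ∈ A.parity α
  /-- The bracket is computed componentwise; in particular `[L_i, L_j] ⊆ L_{i+j}`. As the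
  components vanish in degrees below `-1`, the sum contains all pairs of degrees with sum `k`. -/
  proj_bracket : ∀ (x y : L) (k : ℤ), (proj k (A.bracket x y) : L) =
    ∑ i ∈ Finset.Icc (-1 : ℤ) (k + 1), A.bracket (proj i x) (proj (k - i) y)

namespace ZGrading

/-- `L` is transitive: `a ∈ L_j` with `j ≥ 0` and `[a, L_{-1}] = 0` imply `a = 0`. -/
def IsTransitive {F L : Type*} [Field F] [AddCommGroup L] [Module F L]
    {A : LieSuperalgebra F L} (G : A.ZGrading) : Prop :=
  ∀ j : ℤ, 0 ≤ j → ∀ a ∈ G.comp j, (∀ b ∈ G.comp (-1), A.bracket a b = 0) → a = 0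

/-- A `ℤ`-graded subsuperalgebra of `L = ∏ L_j`: a subsuperalgebra which is the product of its
intersections with the `L_j`. -/
def IsGradedSubsuperalgebra {F L : Type*} [Field F] [AddCommGroup L] [Module F L]
    {A : LieSuperalgebra F L} (G : A.ZGrading) (M : Submodule F L) : Prop :=
  A.IsSubsuperalgebra M ∧ ∀ x : L, x ∈ M ↔ ∀ j : ℤ, (G.proj j x : L) ∈ M

/-- `L` is generated, as a `ℤ`-graded Lie superalgebra, by the subset `s`. -/
def IsGeneratedBy {F L : Type*} [Field F] [AddCommGroup L] [Module F L]
    {A : LieSuperalgebra F L} (G : A.ZGrading) (s : Set L) : Prop :=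
  ∀ M : Submodule F L, G.IsGradedSubsuperalgebra M → s ⊆ (M : Set L) → M = ⊤

/-- The pair `(L, μ)` is admissible (with respect to `n`). -/
structure IsAdmissible {F L : Type*} [Field F] [AddCommGroup L] [Module F L]
    {A : LieSuperalgebra F L} (G : A.ZGrading) (n : ℕ) (μ : L) : Prop where
  mem : μ ∈ G.comp ((n : ℤ) - 1)
  homogeneous : ∃ α : ZMod 2, μ ∈ A.parity α
  transitive : G.IsTransitive
  generated : G.IsGeneratedBy ((G.comp (-1) : Set L) ∪ {μ})
  bracket_zero : ∀ D ∈ G.comp 0, A.bracket μ D = 0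

/-- `(ad L_{-1})^k x`: the span of all `[a_1, [a_2, …, [a_k, x]…]]` with `a_i ∈ L_{-1}`. -/
def adPow {F L : Type*} [Field F] [AddCommGroup L] [Module F L]
    {A : LieSuperalgebra F L} (G : A.ZGrading) (x : L) : ℕ → Submodule F L
  | 0 => Submodule.span F {x}
  | k + 1 => Submodule.map₂ A.bracket (G.comp (-1)) (adPow G x k)

end ZGrading

end LieSuperalgebra

/-! Write k = n - 1 for the degree of μ. The heart is that [(ad L_{-1})^p μ, (ad L_{-1})^q μ] = 0
for p + q ≤ k (`bracket_adPow_eq_zero`). This bracket has degree 2k - p - q ≥ 0, so by transitivity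
it suffices that it dies after bracketing with 2k + 1 - p - q further elements of L_{-1}, that is,
in degree -1. Since [L_{-1}, L_{-1}] = 0, the Leibniz rule expands the outcome, for elements v_i
with 2k + 1 indices, as the sum over P ⊆ A ⊆ Qᶜ of h(A) = ±[v_A μ, v_{Aᶜ} μ], where |P| = p and |Q|
= q.

For degree reasons h lives on sets of size k and k + 1. Skew-symmetry gives h(Aᶜ) = κ h(A) with one
sign κ for all A, and [μ, L_0] = 0 makes the sum of h over all A ⊇ P vanish when |P| = k. So h
restricted to k-sets is an eigenfunction of the odd graph with eigenvalue ±1. The eigenvalues of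
that graph are (-1)^i (k + 1 - i), so only i = k can occur, and then the sum over the k-sets
containing a given smaller set is zero. Inclusion-exclusion kills the required interval sums
(`Finset.sum_Icc_eq_zero_of_middle_layers`).

With the Jacobi identity, the vanishing shows that L_{-1} and the (ad L_{-1})^p μ with p ≤ k span a
graded subsuperalgebra, which is L by generation. The case p + q = k says that no bracket has a
component in degree k, so S is an ideal. -/

/-! ### Sums over intervals of the Boolean lattice and the odd graph -/

open Finset in
theorem Finset.sum_Icc_compl_split {ι W : Type*} [Fintype ι] [DecidableEq ι] [AddCommGroup W]
    (g : Finset ι → W) {P Q : Finset ι} {i : ι} :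
    ∑ A ∈ Icc P Qᶜ, g A = ∑ A ∈ Icc (insert i P) Qᶜ, g A + ∑ A ∈ Icc P (insert i Q)ᶜ, g A := by
  rw [← sum_filter_add_sum_filter_not (Icc P Qᶜ) (fun A => i ∈ A)]
  congr 1 <;> refine sum_congr ?_ fun _ _ => rfl
  · ext A
    simp only [mem_filter, mem_Icc, insert_subset_iff]
    tauto
  · ext A
    simp only [mem_filter, mem_Icc, subset_compl_comm (s := A), insert_subset_iff,
      mem_compl]
    tauto

-- Inclusion-exclusion with a single surviving term: moving i from the forbidden set Q to the
-- required set P costs a sign, because the sum in which i is unconstrained reduces to supersets of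
-- fewer than k elements.
open Finset in
theorem Finset.sum_Icc_compl_eq_of_vanishing {ι W : Type*} [Fintype ι] [DecidableEq ι]
    [AddCommGroup W] (g : Finset ι → W) (k : ℕ)
    (hk : ∀ X : Finset ι, #X < k → ∑ A ∈ Icc X ∅ᶜ, g A = 0) (Q : Finset ι) :
    ∀ P : Finset ι, Disjoint P Q → #P + #Q ≤ k →
      ∑ A ∈ Icc P Qᶜ, g A = (-1 : ℤ) ^ #Q • ∑ A ∈ Icc (P ∪ Q) ∅ᶜ, g A := by
  induction Q using Finset.induction_on with
  | empty => intro P _ _; simp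
  | insert i Q hi ih =>
    intro P hd hc
    rw [disjoint_insert_right] at hd
    rw [card_insert_of_notMem hi] at hc
    have h1 := sum_Icc_compl_split g (P := P) (Q := Q) (i := i)
    rw [ih P hd.2 (by omega), hk (P ∪ Q) ((card_union_le _ _).trans_lt (by omega)),
      ih (insert i P) (disjoint_insert_left.2 ⟨hi, hd.2⟩)
        (by rw [card_insert_of_notMem hd.1]; omega)] at h1
    rw [card_insert_of_notMem hi, union_insert, ← insert_union, pow_succ, mul_neg_one, neg_smul]
    rw [smul_zero] at h1
    exact (neg_eq_of_add_eq_zero_right h1.symm).symm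

open Finset in
theorem Finset.card_filter_Icc_card_eq {ι : Type*} [DecidableEq ι] {X A : Finset ι} {m : ℕ}
    (hXA : X ⊆ A) (hA : #A = m + 1) :
    #{P ∈ Icc X A | #P = m} = m + 1 - #X := by
  have : {P ∈ Icc X A | #P = m} = (A \ X).image (fun a => A.erase a) := by
    ext P
    simp only [mem_filter, mem_Icc, mem_image, mem_sdiff]
    constructor
    · rintro ⟨⟨h1, h2⟩, h3⟩
      have h4 : #(A \ P) = 1 := by rw [card_sdiff_of_subset h2]; omega
      obtain ⟨a, ha⟩ := card_eq_one.1 h4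
      have haA : a ∈ A \ P := by simp [ha]
      rw [mem_sdiff] at haA
      refine ⟨a, ⟨haA.1, fun h => haA.2 (h1 h)⟩, ?_⟩
      rw [erase_eq, ← ha, sdiff_sdiff_eq_self h2]
    · rintro ⟨a, ⟨h1, h2⟩, rfl⟩
      exact ⟨⟨subset_erase.2 ⟨hXA, h2⟩, erase_subset _ _⟩, by rw [card_erase_of_mem h1]; omega⟩
  rw [this, card_image_of_injOn, card_sdiff_of_subset hXA, hA]
  intro a ha b hb hab
  exact (erase_inj A (mem_sdiff.1 (mem_coe.1 ha)).1).1 hab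

open Finset in
/-- A vector-valued function on the middle layers of the Boolean lattice of a set with `2m+1`
elements which is an eigenfunction of the odd graph for an eigenvalue `±1` has vanishing sums over
the intervals of corank at most `m`. -/
theorem Finset.sum_Icc_eq_zero_of_middle_layers {ι F W : Type*} [Fintype ι] [DecidableEq ι]
    [Field F] [CharZero F] [AddCommGroup W] [Module F W] {m : ℕ}
    (hι : Fintype.card ι = 2 * m + 1) (h : Finset ι → W) (κ : F) (hκ : κ = 1 ∨ κ = -1)
    (h_layers : ∀ A, #A ≠ m → #A ≠ m + 1 → h A = 0)
    (h_compl : ∀ A, h Aᶜ = κ • h A)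
    (h_sum : ∀ P, #P = m → ∑ A ∈ Icc P ∅ᶜ, h A = 0)
    (P Q : Finset ι) (hd : Disjoint P Q) (hc : #P + #Q ≤ m) :
    ∑ A ∈ Icc P Qᶜ, h A = 0 := by
  set g : Finset ι → W := fun A => if #A = m then h A else 0 with hg
  set g' : Finset ι → W := fun A => if #A = m + 1 then h A else 0 with hg'
  have hsplit : ∀ A, h A = g A + g' A := by
    intro A
    by_cases h1 : #A = m
    · simp [hg, hg', h1]
    · by_cases h2 : #A = m + 1
      · simp [hg, hg', h2]
      · simp [hg, hg', h1, h2, h_layers A h1 h2]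
  have hgc : ∀ A, g' Aᶜ = κ • g A := by
    intro A
    have : #Aᶜ = m + 1 ↔ #A = m := by
      have := card_add_card_compl A
      omega
    simp only [hg, hg', this, h_compl]
    split_ifs <;> simp
  have hflip : ∀ P Q : Finset ι, ∑ A ∈ Icc P Qᶜ, g' A = κ • ∑ A ∈ Icc Q Pᶜ, g A := by
    intro P Q
    rw [smul_sum]
    refine sum_nbij' (fun A => Aᶜ) (fun A => Aᶜ) ?_ ?_ ?_ ?_ ?_
    · intro A hA
      simp only [mem_Icc] at hA ⊢
      exact ⟨subset_compl_comm.1 hA.2, compl_subset_compl.2 hA.1⟩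
    · intro A hA
      simp only [mem_Icc] at hA ⊢
      exact ⟨subset_compl_comm.1 hA.2, compl_subset_compl.2 hA.1⟩
    · intro A _; simp
    · intro A _; simp
    · intro A _
      rw [← hgc, compl_compl]
  -- Sum `h_sum` over the m-sets P ⊇ X. An m-set A ⊇ X is counted once, an (m+1)-set A ⊇ X once for
  -- each of its m + 1 - |X| elements outside X; complementation turns the latter into m-sets
  -- disjoint from X.
  have hrel : ∀ X : Finset ι, #X ≤ m →
      ∑ A ∈ Icc X ∅ᶜ, g A + (κ * ((m + 1 - #X : ℕ) : F)) • ∑ A ∈ Icc ∅ Xᶜ, g A = 0 := by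
    intro X hX
    have h0 : ∑ P ∈ {P ∈ Icc X ∅ᶜ | #P = m}, ∑ A ∈ Icc P ∅ᶜ, h A = 0 :=
      sum_eq_zero fun P hP => h_sum P (mem_filter.1 hP).2
    rw [sum_comm' (t' := Icc X ∅ᶜ) (s' := fun A => {P ∈ Icc X A | #P = m})] at h0
    · rw [mul_comm, mul_smul, ← hflip, smul_sum, ← sum_add_distrib, ← h0]
      refine sum_congr rfl fun A hA => ?_
      have hXA : X ⊆ A := (mem_Icc.1 hA).1
      rw [sum_const]
      by_cases h1 : #A = m
      · have : {P ∈ Icc X A | #P = m} = {A} := by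
          ext P
          simp only [mem_filter, mem_Icc, mem_singleton]
          constructor
          · rintro ⟨⟨_, h2⟩, h3⟩
            exact eq_of_subset_of_card_le h2 (by omega)
          · rintro rfl
            exact ⟨⟨hXA, subset_rfl⟩, h1⟩
        simp [this, hg, hg', h1]
      · by_cases h2 : #A = m + 1
        · rw [card_filter_Icc_card_eq hXA h2]
          simp [hg, hg', h2, Nat.cast_smul_eq_nsmul]
        · simp [hg, hg', h1, h2, h_layers A h1 h2]
    · intro P A
      simp only [mem_filter, mem_Icc, compl_empty, subset_univ, and_true]
      constructor
      · rintro ⟨⟨h1, h2⟩, h3⟩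
        exact ⟨⟨⟨h1, h3⟩, h2⟩, h1.trans h3⟩
      · rintro ⟨⟨⟨h1, h3⟩, h2⟩, _⟩
        exact ⟨⟨h1, h2⟩, h3⟩
  -- Once the sums for smaller sets vanish, the sum over sets disjoint from X is (-1)^|X| times the
  -- sum over sets containing X, so `hrel` becomes a scalar equation.
  have hrel' : ∀ X : Finset ι, #X ≤ m → (∀ Y : Finset ι, #Y < #X → ∑ A ∈ Icc Y ∅ᶜ, g A = 0) →
      (1 + κ * ((m + 1 - #X : ℕ) : F) * (-1) ^ #X) • ∑ A ∈ Icc X ∅ᶜ, g A = 0 := by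
    intro X hX hY
    have h1 := sum_Icc_compl_eq_of_vanishing g #X hY X ∅ (disjoint_empty_left _) (by simp)
    have h2 := hrel X hX
    rw [h1, empty_union, ← Int.cast_smul_eq_zsmul F] at h2
    push_cast at h2
    rw [add_smul, one_smul, mul_smul _ ((-1 : F) ^ #X)]
    exact h2
  have hlow : ∀ k, ∀ X : Finset ι, #X = k → #X < m → ∑ A ∈ Icc X ∅ᶜ, g A = 0 := by
    intro k
    induction k using Nat.strong_induction_on with
    | _ k ih =>
      intro X hk hX
      have h1 := hrel' X hX.le fun Y hY => ih #Y (hk ▸ hY) Y rfl (hY.trans hX)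
      refine (smul_eq_zero.1 h1).resolve_left ?_
      -- The scalar is 1 ± (d + 2), that is d + 3 or -(d + 1), nonzero in characteristic 0.
      obtain ⟨d, hd⟩ : ∃ d, m + 1 - #X = d + 2 := ⟨m - 1 - #X, by omega⟩
      rw [hd]
      push_cast
      have e1 : (d : F) + 3 ≠ 0 := by exact_mod_cast (by omega : d + 3 ≠ 0)
      have e2 : (d : F) + 1 ≠ 0 := by exact_mod_cast (by omega : d + 1 ≠ 0)
      rcases hκ with rfl | rfl <;> rcases neg_one_pow_eq_or F #X with e | e <;> rw [e] <;> intro h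
      · exact e1 (by linear_combination h)
      · exact e2 (by linear_combination -h)
      · exact e2 (by linear_combination -h)
      · exact e1 (by linear_combination h)
  have hm : ∀ X : Finset ι, #X < m → ∑ A ∈ Icc X ∅ᶜ, g A = 0 := fun X hX => hlow _ X rfl hX
  have hsum : ∑ A ∈ Icc P Qᶜ, h A = ∑ A ∈ Icc P Qᶜ, g A + ∑ A ∈ Icc P Qᶜ, g' A := by
    rw [← sum_add_distrib]
    exact sum_congr rfl fun A _ => hsplit A
  rw [hsum, hflip, sum_Icc_compl_eq_of_vanishing g m hm Q P hd hc,
    sum_Icc_compl_eq_of_vanishing g m hm P Q hd.symm (by omega), union_comm Q P]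
  rcases hc.lt_or_eq with hc | hc
  · rw [hm (P ∪ Q) (by rw [card_union_of_disjoint hd]; exact hc)]
    simp
  -- For |P| + |Q| = m the sum of g need not vanish, but the scalar 1 + κ(-1)^m from `hrel'`
  -- annihilates it, and this scalar divides the coefficient obtained here.
  · have hPQ : #(P ∪ Q) = m := by rw [card_union_of_disjoint hd, hc]
    have h1 := hrel' (P ∪ Q) hPQ.le (by rw [hPQ]; exact hm)
    rw [hPQ] at h1
    simp only [Nat.add_sub_cancel_left, Nat.cast_one, mul_one] at h1
    rw [← Int.cast_smul_eq_zsmul F, ← Int.cast_smul_eq_zsmul F, smul_smul, ← add_smul]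
    push_cast
    have e : (-1 : F) ^ #Q + κ * (-1) ^ #P = (-1) ^ #Q * (1 + κ * (-1) ^ m) := by
      rw [← hc, pow_add]
      have : (-1 : F) ^ #Q * (-1) ^ #Q = 1 := by rw [← mul_pow]; simp
      linear_combination (-κ * (-1) ^ #P) * this
    rw [e, mul_smul, h1, smul_zero]

/-! ### Koszul signs -/

namespace LieSuperalgebra

section Koszul

variable (F : Type*) [Field F]

/-- The sign for interchanging elements of parities `a` and `b`. -/
def koszul (a b : ZMod 2) : F := (-1) ^ (a.val * b.val)

theorem koszul_comm (a b : ZMod 2) : koszul F a b = koszul F b a := by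
  simp only [koszul, mul_comm]

theorem koszul_add_left (a b c : ZMod 2) :
    koszul F (a + b) c = koszul F a c * koszul F b c := by
  have h : (a + b).val * c.val % 2 = (a.val * c.val + b.val * c.val) % 2 := by
    revert a b c
    decide
  simp only [koszul]
  rw [← pow_add, neg_one_pow_eq_pow_mod_two, h, ← neg_one_pow_eq_pow_mod_two]

theorem koszul_add_right (a b c : ZMod 2) :
    koszul F a (b + c) = koszul F a b * koszul F a c := by
  simp only [koszul_comm F a, koszul_add_left]

theorem koszul_mul_self (a b : ZMod 2) : koszul F a b * koszul F a b = 1 := by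
  rw [koszul, ← mul_pow]
  simp

theorem koszul_zero_left (a : ZMod 2) : koszul F 0 a = 1 := by simp [koszul]

theorem koszul_ne_zero (a b : ZMod 2) : koszul F a b ≠ 0 :=
  left_ne_zero_of_mul_eq_one (koszul_mul_self F a b)

variable {ι : Type*} [LinearOrder ι] (π : ι → ZMod 2)

/-- The sign of the permutation sorting the concatenation of the increasing enumerations of
`s` and `t`, where the index `i` has parity `π i`. -/
def koszulProd (s t : Finset ι) : F :=
  ∏ a ∈ s, ∏ b ∈ t, if b < a then koszul F (π a) (π b) else 1

theorem koszulProd_insert_left {i : ι} {s : Finset ι} (hi : i ∉ s) (t : Finset ι) :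
    koszulProd F π (insert i s) t = koszulProd F π {i} t * koszulProd F π s t := by
  simp [koszulProd, Finset.prod_insert hi]

theorem koszulProd_insert_right (s : Finset ι) {i : ι} {t : Finset ι} (hi : i ∉ t) :
    koszulProd F π s (insert i t) = koszulProd F π s {i} * koszulProd F π s t := by
  simp only [koszulProd, Finset.prod_insert hi, Finset.prod_mul_distrib, Finset.prod_singleton]

theorem koszulProd_union_right (s : Finset ι) {t u : Finset ι} (h : Disjoint t u) :
    koszulProd F π s (t ∪ u) = koszulProd F π s t * koszulProd F π s u := by
  simp [koszulProd, Finset.prod_union h, Finset.prod_mul_distrib]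

theorem koszulProd_mul_self (s t : Finset ι) :
    koszulProd F π s t * koszulProd F π s t = 1 := by
  simp only [koszulProd, ← Finset.prod_mul_distrib]
  refine Finset.prod_eq_one fun a _ => Finset.prod_eq_one fun b _ => ?_
  split_ifs
  · exact koszul_mul_self F _ _
  · simp

theorem koszulProd_ne_zero (s t : Finset ι) : koszulProd F π s t ≠ 0 :=
  left_ne_zero_of_mul_eq_one (koszulProd_mul_self F π s t)

theorem koszul_sum_left (s : Finset ι) (c : ZMod 2) :
    koszul F (∑ a ∈ s, π a) c = ∏ a ∈ s, koszul F (π a) c := by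
  induction s using Finset.induction_on with
  | empty => simp [koszul_zero_left]
  | insert i s hi ih => rw [Finset.sum_insert hi, Finset.prod_insert hi, koszul_add_left, ih]

theorem koszul_sum_right (s : Finset ι) (c : ZMod 2) :
    koszul F c (∑ a ∈ s, π a) = ∏ a ∈ s, koszul F c (π a) := by
  simp only [koszul_comm F c, koszul_sum_left]

/-- Each pair (a, b) is an inversion in exactly one of the two concatenations. -/
theorem koszulProd_mul_koszulProd_swap {s t : Finset ι} (h : Disjoint s t) :
    koszulProd F π s t * koszulProd F π t s = koszul F (∑ a ∈ s, π a) (∑ b ∈ t, π b) := by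
  rw [koszulProd, koszulProd, Finset.prod_comm (s := t), koszul_sum_left,
    ← Finset.prod_mul_distrib]
  refine Finset.prod_congr rfl fun a ha => ?_
  rw [koszul_sum_right, ← Finset.prod_mul_distrib]
  refine Finset.prod_congr rfl fun b hb => ?_
  rcases lt_trichotomy a b with hab | rfl | hab
  · rw [if_neg hab.not_gt, if_pos hab, one_mul, koszul_comm]
  · exact absurd hb (Finset.disjoint_left.1 h ha)
  · rw [if_pos hab, if_neg hab.not_gt, mul_one]

end Koszul

/-! ### Iterated brackets indexed by finite sets -/

section Nested

theorem bracket_bracket_comm {F L : Type*} [Field F] [AddCommGroup L] [Module F L]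
    (A : LieSuperalgebra F L) {a b : L} {α β : ZMod 2} (ha : a ∈ A.parity α)
    (hb : b ∈ A.parity β) (hab : A.bracket a b = 0) (x : L) :
    A.bracket a (A.bracket b x) = koszul F α β • A.bracket b (A.bracket a x) := by
  rw [A.jacobi x ha hb, hab, map_zero, LinearMap.zero_apply, zero_add, koszul]

variable {F L : Type*} [Field F] [AddCommGroup L] [Module F L] (A : LieSuperalgebra F L)
  {ι : Type*} [LinearOrder ι]

/-- The iterated bracket of `μ` with the `v i`, `i ∈ s`, in increasing order. -/
def nested (v : ι → L) (μ : L) (s : Finset ι) : L :=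
  (s.sort (· ≤ ·)).foldr (fun i x => A.bracket (v i) x) μ

theorem nested_empty (v : ι → L) (μ : L) : A.nested v μ ∅ = μ := by
  simp [nested]

theorem nested_insert_of_forall_lt (v : ι → L) (μ : L) {i : ι} {s : Finset ι}
    (h : ∀ j ∈ s, i < j) :
    A.nested v μ (insert i s) = A.bracket (v i) (A.nested v μ s) := by
  rw [nested, Finset.sort_insert _ (fun j hj => (h j hj).le) (fun hi => (h i hi).false)]
  rfl

theorem nested_congr {v w : ι → L} (μ : L) {s : Finset ι} (h : ∀ i ∈ s, v i = w i) :
    A.nested v μ s = A.nested w μ s := by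
  induction s using Finset.induction_on_min with
  | empty => simp [nested_empty]
  | insert i s hi ih =>
    rw [nested_insert_of_forall_lt A v μ hi, nested_insert_of_forall_lt A w μ hi,
      h i (Finset.mem_insert_self _ _), ih fun j hj => h j (Finset.mem_insert_of_mem hj)]

variable {v : ι → L} {π : ι → ZMod 2} {μ : L} {m : ZMod 2}

theorem nested_mem_parity (hv : ∀ i, v i ∈ A.parity (π i)) (hμ : μ ∈ A.parity m) (s : Finset ι) :
    A.nested v μ s ∈ A.parity (∑ i ∈ s, π i + m) := by
  induction s using Finset.induction_on_min with
  | empty => simpa [nested_empty] using hμ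
  | insert i s hi ih =>
    rw [nested_insert_of_forall_lt A v μ hi, Finset.sum_insert fun h => (hi i h).false, add_assoc]
    exact A.bracket_mem (hv i) ih

/-- The v j supercommute, so ad (v i) moves inward past the smaller indices at the cost of their
Koszul signs. -/
theorem nested_insert (hv : ∀ i, v i ∈ A.parity (π i))
    (hvv : ∀ i j, A.bracket (v i) (v j) = 0) (i : ι) (s : Finset ι) (hi : i ∉ s) :
    A.nested v μ (insert i s) = koszulProd F π {i} s • A.bracket (v i) (A.nested v μ s) := by
  induction s using Finset.induction_on_min with
  | empty => rw [nested_insert_of_forall_lt A v μ (by simp)]; simp [koszulProd]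
  | insert j s hj ih =>
    rw [Finset.mem_insert, not_or] at hi
    have hjs : j ∉ s := fun h => (hj j h).false
    rcases lt_or_gt_of_ne hi.1 with h | h
    · have hlt : ∀ k ∈ insert j s, i < k := by
        intro k hk
        rcases Finset.mem_insert.1 hk with rfl | hk
        · exact h
        · exact h.trans (hj k hk)
      rw [nested_insert_of_forall_lt A v μ hlt]
      have : koszulProd F π {i} (insert j s) = 1 := by
        rw [koszulProd, Finset.prod_singleton]
        exact Finset.prod_eq_one fun k hk => if_neg (hlt k hk).not_gt
      rw [this, one_smul]
    · have hlt : ∀ k ∈ insert i s, j < k := by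
        intro k hk
        rcases Finset.mem_insert.1 hk with rfl | hk
        · exact h
        · exact hj k hk
      rw [Finset.insert_comm, nested_insert_of_forall_lt A v μ hlt,
        nested_insert_of_forall_lt A v μ hj, ih hi.2, map_smul,
        A.bracket_bracket_comm (hv j) (hv i) (hvv j i), smul_smul, koszulProd_insert_right F π _ hjs]
      congr 1
      simp [koszulProd, h, koszul_comm F (π i), mul_comm]

variable (v π μ m) in
/-- The bracket of `nested v μ s` and `nested v μ t`, with the sign with which it occurs in the
expansion of the iterated bracket of `[μ, μ]` with all `v i`, `i ∈ s ∪ t`. -/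
def nestedBracket (s t : Finset ι) : L :=
  (koszulProd F π s t * koszul F m (∑ i ∈ t, π i)) •
    A.bracket (A.nested v μ s) (A.nested v μ t)

theorem nestedBracket_eq_zero_iff (s t : Finset ι) :
    A.nestedBracket v π μ m s t = 0 ↔ A.bracket (A.nested v μ s) (A.nested v μ t) = 0 := by
  rw [nestedBracket, smul_eq_zero_iff_right]
  exact mul_ne_zero (koszulProd_ne_zero F π s t) (koszul_ne_zero F _ _)

/-- The normalising sign absorbs all parities of the v i; the remaining factor depends only on μ and
becomes κ in the combinatorial lemma. -/
theorem nestedBracket_swap (hv : ∀ i, v i ∈ A.parity (π i)) (hμ : μ ∈ A.parity m)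
    {s t : Finset ι} (h : Disjoint s t) :
    A.nestedBracket v π μ m t s = -koszul F m m • A.nestedBracket v π μ m s t := by
  rw [nestedBracket, nestedBracket,
    A.skew (A.nested_mem_parity hv hμ t) (A.nested_mem_parity hv hμ s), ← koszul,
    smul_neg, smul_smul, smul_smul, neg_mul, neg_smul]
  congr 2
  have h1 := koszulProd_mul_koszulProd_swap F π h
  have h2 := koszul_mul_self F m (∑ i ∈ s, π i)
  have h3 := koszulProd_mul_self F π t s
  rw [koszul_add_left, koszul_add_right, koszul_add_right, koszul_comm F (∑ i ∈ t, π i) m,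
    koszul_comm F (∑ i ∈ t, π i), ← h1]
  linear_combination (koszulProd F π s t * koszul F m (∑ i ∈ t, π i) * koszul F m m) *
    (koszulProd F π t s * koszulProd F π t s * h2 + h3)

/-- The purpose of the normalisation: the super Leibniz rule becomes free of signs on the right, so
iterating it gives plain sums over subsets. -/
theorem nestedBracket_leibniz (hv : ∀ i, v i ∈ A.parity (π i)) (hμ : μ ∈ A.parity m)
    (hvv : ∀ i j, A.bracket (v i) (v j) = 0) {s t : Finset ι} (h : Disjoint s t) {i : ι}
    (hs : i ∉ s) (ht : i ∉ t) :
    koszulProd F π {i} (s ∪ t) • A.bracket (v i) (A.nestedBracket v π μ m s t) =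
      A.nestedBracket v π μ m (insert i s) t + A.nestedBracket v π μ m s (insert i t) := by
  simp only [nestedBracket]
  rw [map_smul, A.jacobi _ (hv i) (A.nested_mem_parity hv hμ s), ← koszul,
    A.nested_insert hv hvv i s hs, A.nested_insert hv hvv i t ht, map_smul, map_smul,
    LinearMap.smul_apply, smul_smul, smul_smul, smul_smul, smul_add, smul_smul,
    koszulProd_insert_left F π hs, koszulProd_insert_right F π _ ht,
    koszulProd_union_right F π _ h, Finset.sum_insert ht]
  congr 2
  · ring
  · have h1 := koszulProd_mul_koszulProd_swap F π (Finset.disjoint_singleton_left.2 hs)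
    have h2 := koszulProd_mul_self F π {i} s
    rw [Finset.sum_singleton] at h1
    rw [koszul_add_right, koszul_add_right, koszul_comm F (π i) m, ← h1]
    linear_combination (koszulProd F π {i} t * koszulProd F π s t * koszulProd F π s {i} *
      koszul F m (π i) * koszul F m (∑ i ∈ t, π i)) * h2

theorem nestedBracket_congr {w : ι → L} {ρ : ι → ZMod 2} {s t : Finset ι}
    (h : ∀ i ∈ s ∪ t, v i = w i) (h' : ∀ i ∈ s ∪ t, π i = ρ i) :
    A.nestedBracket v π μ m s t = A.nestedBracket w ρ μ m s t := by
  rw [nestedBracket, nestedBracket,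
    A.nested_congr μ fun i hi => h i (Finset.mem_union_left _ hi),
    A.nested_congr μ fun i hi => h i (Finset.mem_union_right _ hi),
    Finset.sum_congr rfl fun i hi => h' i (Finset.mem_union_right _ hi)]
  congr 2
  refine Finset.prod_congr rfl fun a ha => Finset.prod_congr rfl fun b hb => ?_
  rw [h' a (Finset.mem_union_left _ ha), h' b (Finset.mem_union_right _ hb)]

variable (v π μ m) in
/-- The expansion of the iterated bracket of `nestedBracket s t` with the `v i`, `i ∈ r`. -/
def nestedBracketSum (r s t : Finset ι) : L :=
  ∑ u ∈ r.powerset, A.nestedBracket v π μ m (s ∪ u) (t ∪ (r \ u))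

theorem nestedBracketSum_empty (s t : Finset ι) :
    A.nestedBracketSum v π μ m ∅ s t = A.nestedBracket v π μ m s t := by
  simp [nestedBracketSum]

theorem nestedBracketSum_insert (hv : ∀ i, v i ∈ A.parity (π i)) (hμ : μ ∈ A.parity m)
    (hvv : ∀ i j, A.bracket (v i) (v j) = 0) {r s t : Finset ι} (hst : Disjoint s t)
    (hr : Disjoint r (s ∪ t)) {i : ι} (hi : i ∉ r ∪ (s ∪ t)) :
    A.nestedBracketSum v π μ m (insert i r) s t =
      koszulProd F π {i} (r ∪ (s ∪ t)) • A.bracket (v i) (A.nestedBracketSum v π μ m r s t) := by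
  simp only [Finset.mem_union, not_or] at hi
  rw [nestedBracketSum, Finset.sum_powerset_insert hi.1, nestedBracketSum, map_sum,
    Finset.smul_sum, ← Finset.sum_add_distrib]
  refine Finset.sum_congr rfl fun u hu => ?_
  rw [Finset.mem_powerset] at hu
  have hiu : i ∉ u := fun h => hi.1 (hu h)
  rw [Finset.disjoint_union_right] at hr
  have hdisj : Disjoint (s ∪ u) (t ∪ r \ u) := by
    rw [Finset.disjoint_union_left, Finset.disjoint_union_right, Finset.disjoint_union_right]
    exact ⟨⟨hst, hr.1.symm.mono_right Finset.sdiff_subset⟩, hr.2.mono_left hu,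
      Finset.disjoint_sdiff⟩
  have hun : r ∪ (s ∪ t) = (s ∪ u) ∪ (t ∪ r \ u) := by
    ext x
    have := @hu x
    simp only [Finset.mem_union, Finset.mem_sdiff]
    tauto
  rw [hun, A.nestedBracket_leibniz hv hμ hvv hdisj (by simp [hi, hiu]) (by simp [hi]), add_comm,
    Finset.union_insert, Finset.insert_sdiff_of_notMem _ hiu, Finset.union_insert,
    Finset.insert_sdiff_insert, Finset.sdiff_insert_of_notMem hi.1]

theorem nestedBracketSum_congr {w : ι → L} {ρ : ι → ZMod 2} {r s t : Finset ι}
    (h : ∀ i ∈ r ∪ (s ∪ t), v i = w i) (h' : ∀ i ∈ r ∪ (s ∪ t), π i = ρ i) :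
    A.nestedBracketSum v π μ m r s t = A.nestedBracketSum w ρ μ m r s t := by
  refine Finset.sum_congr rfl fun u hu => ?_
  have hsub : (s ∪ u) ∪ (t ∪ r \ u) ⊆ r ∪ (s ∪ t) := by
    intro x
    have h : x ∈ u → x ∈ r := fun h => Finset.mem_powerset.1 hu h
    simp only [Finset.mem_union, Finset.mem_sdiff]
    tauto
  exact A.nestedBracket_congr (fun i hi => h i (hsub hi)) fun i hi => h' i (hsub hi)

/-- When all remaining indices are used up, the second argument is the complement of the first,
which leaves a sum over a Boolean interval. -/
theorem nestedBracketSum_compl [Fintype ι] {s t : Finset ι} (hst : Disjoint s t) :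
    A.nestedBracketSum v π μ m (s ∪ t)ᶜ s t =
      ∑ u ∈ Finset.Icc s tᶜ, A.nestedBracket v π μ m u uᶜ := by
  have hs : s ⊆ tᶜ := Finset.subset_compl_iff_disjoint_right.2 hst
  rw [Finset.Icc_eq_image_powerset hs, Finset.sum_image, nestedBracketSum]
  · have : tᶜ \ s = (s ∪ t)ᶜ := by ext; simp; tauto
    rw [this]
    refine Finset.sum_congr rfl fun u hu => ?_
    congr 1
    ext x
    have h1 : x ∈ u → x ∈ (s ∪ t)ᶜ := fun h => Finset.mem_powerset.1 hu h
    have h2 := @hs x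
    simp only [Finset.mem_union, Finset.mem_sdiff, Finset.mem_compl] at h1 h2 ⊢
    tauto
  · intro u hu w hw huw
    have hu := Finset.mem_powerset.1 (Finset.mem_coe.1 hu)
    have hw := Finset.mem_powerset.1 (Finset.mem_coe.1 hw)
    ext x
    have h1 := @hu x
    have h2 := @hw x
    have h3 := Finset.ext_iff.1 huw x
    simp only [Finset.mem_union, Finset.mem_sdiff] at h1 h2 h3
    tauto

end Nested

end LieSuperalgebra

/-! ### Gradings, transitivity and iterated brackets -/

namespace LieSuperalgebra

namespace ZGrading

variable {F L : Type*} [Field F] [AddCommGroup L] [Module F L] {A : LieSuperalgebra F L}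
  (G : A.ZGrading)

theorem ext_proj {x y : L} (h : ∀ j, (G.proj j x : L) = G.proj j y) : x = y :=
  G.bijective.1 (funext fun j => Subtype.ext (h j))

theorem proj_self {j : ℤ} {x : L} (hx : x ∈ G.comp j) : (G.proj j x : L) = x := by
  rw [G.proj_of_mem j j x hx, if_pos rfl]

theorem proj_of_ne {i j : ℤ} {x : L} (hx : x ∈ G.comp i) (h : j ≠ i) : (G.proj j x : L) = 0 := by
  rw [G.proj_of_mem i j x hx, if_neg h]

theorem eq_zero_of_mem_comp {j : ℤ} (hj : j < -1) {x : L} (hx : x ∈ G.comp j) : x = 0 := by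
  rwa [G.comp_eq_bot j hj, Submodule.mem_bot] at hx

theorem bracket_mem_comp {i j : ℤ} {x y : L} (hx : x ∈ G.comp i) (hy : y ∈ G.comp j) :
    A.bracket x y ∈ G.comp (i + j) := by
  suffices h : A.bracket x y = G.proj (i + j) (A.bracket x y) by
    rw [h]
    exact Submodule.coe_mem _
  refine G.ext_proj fun k => ?_
  rcases eq_or_ne k (i + j) with rfl | hk
  · rw [G.proj_self (Submodule.coe_mem _)]
  · rw [G.proj_of_ne (Submodule.coe_mem (G.proj (i + j) (A.bracket x y))) hk, G.proj_bracket]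
    refine Finset.sum_eq_zero fun l _ => ?_
    rcases eq_or_ne l i with rfl | hl
    · rw [G.proj_of_ne hy (by omega : k - l ≠ j), map_zero]
    · rw [G.proj_of_ne hx hl, map_zero, LinearMap.zero_apply]

theorem exists_parity_add {j : ℤ} {x : L} (hx : x ∈ G.comp j) :
    ∃ a ∈ G.comp j ⊓ A.parity 0, ∃ b ∈ G.comp j ⊓ A.parity 1, a + b = x := by
  obtain ⟨a, ha, b, hb, hab⟩ := Submodule.mem_sup.1
    (A.isCompl_parity.sup_eq_top ▸ Submodule.mem_top : x ∈ A.parity 0 ⊔ A.parity 1)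
  refine ⟨_, ⟨Submodule.coe_mem (G.proj j a), G.proj_parity 0 a ha j⟩,
    _, ⟨Submodule.coe_mem (G.proj j b), G.proj_parity 1 b hb j⟩, ?_⟩
  rw [← Submodule.coe_add, ← map_add, hab, G.proj_self hx]

theorem comp_eq_span_homogeneous (j : ℤ) :
    G.comp j = Submodule.span F {x | ∃ α, x ∈ G.comp j ⊓ A.parity α} := by
  apply le_antisymm
  · intro x hx
    obtain ⟨a, ha, b, hb, rfl⟩ := G.exists_parity_add hx
    exact add_mem (Submodule.subset_span ⟨0, ha⟩) (Submodule.subset_span ⟨1, hb⟩)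
  · rw [Submodule.span_le]
    rintro x ⟨α, hx⟩
    exact hx.1

theorem adPow_succ (x : L) (k : ℕ) :
    G.adPow x (k + 1) = Submodule.map₂ A.bracket (G.comp (-1)) (G.adPow x k) := rfl

theorem adPow_le_comp {x : L} {d : ℤ} (hx : x ∈ G.comp d) (k : ℕ) :
    G.adPow x k ≤ G.comp (d - k) := by
  induction k with
  | zero => simpa [adPow, Submodule.span_le] using hx
  | succ k ih =>
    rw [adPow_succ, Submodule.map₂_le]
    intro a ha b hb
    convert G.bracket_mem_comp ha (ih hb) using 2
    push_cast
    ring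

theorem bracket_eq_zero_of_mem_comp_neg_one {a b : L} (ha : a ∈ G.comp (-1))
    (hb : b ∈ G.comp (-1)) : A.bracket a b = 0 :=
  G.eq_zero_of_mem_comp (by norm_num) (G.bracket_mem_comp ha hb)

variable {G} in
theorem IsTransitive.eq_zero (hG : G.IsTransitive) {j : ℤ} (hj : 0 ≤ j) {x : L}
    (hx : x ∈ G.comp j)
    (h : ∀ α, ∀ b ∈ G.comp (-1) ⊓ A.parity α, A.bracket b x = 0) : x = 0 := by
  obtain ⟨y, hy, z, hz, rfl⟩ := G.exists_parity_add hx
  refine hG j hj _ hx fun c hc => ?_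
  have key : ∀ α, ∀ b ∈ G.comp (-1) ⊓ A.parity α, A.bracket (y + z) b = 0 := by
    intro α b hb
    have h1 := h α b hb
    have hby := A.bracket_mem hb.2 hy.2
    have hbz := A.bracket_mem hb.2 hz.2
    rw [map_add] at h1
    -- [b, y] and [b, z] have opposite parities, so their sum vanishes only if both do;
    -- skew-symmetry can then be applied to each homogeneous part.
    have hdisj : Disjoint (A.parity (α + 0)) (A.parity (α + 1)) := by
      fin_cases α
      · exact A.isCompl_parity.disjoint
      · exact A.isCompl_parity.disjoint.symm
    have h2 : A.bracket b y = 0 := by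
      refine Submodule.disjoint_def.1 hdisj _ hby ?_
      rw [eq_neg_of_add_eq_zero_left h1]
      exact neg_mem hbz
    have h3 : A.bracket b z = 0 := by rwa [h2, zero_add] at h1
    rw [map_add, LinearMap.add_apply, A.skew hy.2 hb.2, A.skew hz.2 hb.2, h2, h3]
    simp
  obtain ⟨a, ha, b, hb, rfl⟩ := G.exists_parity_add hc
  rw [map_add, key 0 a ha, key 1 b hb, add_zero]

section Nested

variable {ι : Type*} [LinearOrder ι] {v : ι → L} {π : ι → ZMod 2} {μ : L} {m : ZMod 2} {d : ℤ}

theorem nested_mem_comp (hv : ∀ i, v i ∈ G.comp (-1)) (hμ : μ ∈ G.comp d) (s : Finset ι) :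
    A.nested v μ s ∈ G.comp (d - s.card) := by
  induction s using Finset.induction_on_min with
  | empty => simpa [nested_empty] using hμ
  | insert i s hi ih =>
    rw [nested_insert_of_forall_lt A v μ hi,
      Finset.card_insert_of_notMem fun h => (hi i h).false]
    convert G.bracket_mem_comp (hv i) ih using 2
    push_cast
    ring

theorem nestedBracket_mem_comp (hv : ∀ i, v i ∈ G.comp (-1)) (hμ : μ ∈ G.comp d)
    (s t : Finset ι) :
    A.nestedBracket v π μ m s t ∈ G.comp (2 * d - s.card - t.card) := by
  refine Submodule.smul_mem _ _ ?_
  convert G.bracket_mem_comp (G.nested_mem_comp hv hμ s) (G.nested_mem_comp hv hμ t) using 2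
  ring

theorem nestedBracketSum_mem_comp (hv : ∀ i, v i ∈ G.comp (-1)) (hμ : μ ∈ G.comp d)
    {r s t : Finset ι} (hr : Disjoint r (s ∪ t)) :
    A.nestedBracketSum v π μ m r s t ∈ G.comp (2 * d - r.card - s.card - t.card) := by
  rw [Finset.disjoint_union_right] at hr
  refine Submodule.sum_mem _ fun u hu => ?_
  rw [Finset.mem_powerset] at hu
  convert G.nestedBracket_mem_comp hv hμ (s ∪ u) (t ∪ r \ u) using 2
  rw [Finset.card_union_of_disjoint (hr.1.symm.mono_right hu),
    Finset.card_union_of_disjoint (hr.2.symm.mono_right Finset.sdiff_subset),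
    ← Finset.card_sdiff_add_card_eq_card hu]
  push_cast
  ring

theorem nestedBracketSum_eq_zero (hv : ∀ i, v i ∈ G.comp (-1) ⊓ A.parity (π i))
    (hμ : μ ∈ A.parity m) {s t : Finset ι} (hst : Disjoint s t)
    (h : A.nestedBracket v π μ m s t = 0) (r : Finset ι) (hr : Disjoint r (s ∪ t)) :
    A.nestedBracketSum v π μ m r s t = 0 := by
  induction r using Finset.induction_on with
  | empty => rwa [nestedBracketSum_empty]
  | insert i r hi ih =>
    rw [Finset.disjoint_insert_left] at hr
    rw [A.nestedBracketSum_insert (fun i => (hv i).2) hμ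
      (fun i j => G.bracket_eq_zero_of_mem_comp_neg_one (hv i).1 (hv j).1) hst hr.2
      (by rw [Finset.mem_union, not_or]; exact ⟨hi, hr.1⟩), ih hr.2, map_zero, smul_zero]

-- Transitivity removes the indices of r one at a time. The hypothesis ranges over all families v
-- because the element at the removed index must be arbitrary, and the bound on cardinalities keeps
-- the degree nonnegative after each removal.
variable {G} in
theorem IsTransitive.nestedBracket_eq_zero (hG : G.IsTransitive) (hμd : μ ∈ G.comp d)
    (hμ : μ ∈ A.parity m) {s t : Finset ι} (hst : Disjoint s t) (r : Finset ι)
    (hr : Disjoint r (s ∪ t)) (hc : (r.card : ℤ) + s.card + t.card ≤ 2 * d + 1)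
    (h : ∀ (v : ι → L) (π : ι → ZMod 2), (∀ i, v i ∈ G.comp (-1) ⊓ A.parity (π i)) →
      A.nestedBracketSum v π μ m r s t = 0)
    (hv : ∀ i, v i ∈ G.comp (-1) ⊓ A.parity (π i)) :
    A.nestedBracket v π μ m s t = 0 := by
  induction r using Finset.induction_on with
  | empty => rw [← nestedBracketSum_empty]; exact h v π hv
  | insert i r hi ih =>
    rw [Finset.disjoint_insert_left] at hr
    rw [Finset.card_insert_of_notMem hi] at hc
    push_cast at hc
    refine ih hr.2 (by omega) fun w ρ hw => ?_
    refine hG.eq_zero (j := 2 * d - r.card - s.card - t.card) (by omega)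
      (G.nestedBracketSum_mem_comp (fun i => (hw i).1) hμd hr.2) fun α b hb => ?_
    have hw' : ∀ j, Function.update w i b j ∈
        G.comp (-1) ⊓ A.parity (Function.update ρ i α j) := by
      intro j
      rcases eq_or_ne j i with rfl | hj
      · simpa using hb
      · simpa [hj] using hw j
    have hi' : i ∉ r ∪ (s ∪ t) := by
      rw [Finset.mem_union, not_or]
      exact ⟨hi, hr.1⟩
    have h1 := h _ _ hw'
    rw [A.nestedBracketSum_insert (fun i => (hw' i).2) hμ
      (fun i j => G.bracket_eq_zero_of_mem_comp_neg_one (hw' i).1 (hw' j).1) hst hr.2 hi',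
      smul_eq_zero_iff_right (koszulProd_ne_zero F _ _ _), Function.update_self] at h1
    rwa [A.nestedBracketSum_congr (w := Function.update w i b) (ρ := Function.update ρ i α)]
    · intro j hj
      rw [Function.update_of_ne (ne_of_mem_of_not_mem hj hi')]
    · intro j hj
      rw [Function.update_of_ne (ne_of_mem_of_not_mem hj hi')]

/-- The index set s may be any set of the right size, so that two iterated brackets can be placed on
disjoint subsets of one index set. -/
theorem adPow_card_le_span_nested (μ : L) (s : Finset ι) :
    G.adPow μ s.card ≤ Submodule.span F {x | ∃ (v : ι → L) (π : ι → ZMod 2),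
      (∀ i, v i ∈ G.comp (-1) ⊓ A.parity (π i)) ∧ A.nested v μ s = x} := by
  induction s using Finset.induction_on with
  | empty =>
    rw [Finset.card_empty, adPow]
    refine Submodule.span_mono ?_
    rw [Set.singleton_subset_iff]
    exact ⟨0, 0, fun i => Submodule.zero_mem _, A.nested_empty _ _⟩
  | insert i s hi ih =>
    rw [Finset.card_insert_of_notMem hi, adPow_succ]
    refine (Submodule.map₂_le_map₂_right ih).trans ?_
    nth_rewrite 1 [G.comp_eq_span_homogeneous (-1)]
    rw [Submodule.map₂_span_span, Submodule.span_le]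
    rintro _ ⟨b, ⟨α, hb⟩, _, ⟨w, ρ, hw, rfl⟩, rfl⟩
    have hw' : ∀ j, Function.update w i b j ∈
        G.comp (-1) ⊓ A.parity (Function.update ρ i α j) := by
      intro j
      rcases eq_or_ne j i with rfl | hj
      · simpa using hb
      · simpa [hj] using hw j
    have h1 := A.nested_insert (μ := μ) (fun i => (hw' i).2)
      (fun i j => G.bracket_eq_zero_of_mem_comp_neg_one (hw' i).1 (hw' j).1) i s hi
    rw [Function.update_self, A.nested_congr (w := w) μ fun j hj =>
      Function.update_of_ne (ne_of_mem_of_not_mem hj hi) _ _] at h1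
    rw [SetLike.mem_coe, ← Submodule.smul_mem_iff _ (koszulProd_ne_zero F (Function.update ρ i α)
      {i} s), ← h1]
    exact Submodule.subset_span ⟨_, _, hw', rfl⟩

end Nested

end ZGrading

end LieSuperalgebra

/-! ### Brackets between the spaces (ad L_{-1})^p μ -/

namespace LieSuperalgebra

theorem mem_of_add_mem {F L : Type*} [Field F] [AddCommGroup L] [Module F L]
    (A : LieSuperalgebra F L) {N : Submodule F L}
    (hN : N ≤ Submodule.span F {x | x ∈ N ∧ ∃ α, x ∈ A.parity α}) {a b : L}
    (ha : a ∈ A.parity 0) (hb : b ∈ A.parity 1) (hab : a + b ∈ N) : a ∈ N ∧ b ∈ N := by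
  have h : N ≤ (N ⊓ A.parity 0) ⊔ (N ⊓ A.parity 1) := by
    refine hN.trans (Submodule.span_le.2 ?_)
    rintro x ⟨hx, α, hα⟩
    fin_cases α
    · exact Submodule.mem_sup_left ⟨hx, hα⟩
    · exact Submodule.mem_sup_right ⟨hx, hα⟩
  obtain ⟨y, hy, z, hz, hyz⟩ := Submodule.mem_sup.1 (h hab)
  have h0 : a - y = 0 := by
    refine Submodule.disjoint_def.1 A.isCompl_parity.disjoint _ (sub_mem ha hy.2) ?_
    have : a - y = z - b := by
      rw [sub_eq_sub_iff_add_eq_add, ← hyz, add_comm]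
    rw [this]
    exact sub_mem hz.2 hb
  have hay : a = y := sub_eq_zero.1 h0
  subst hay
  rw [add_left_cancel hyz] at hz
  exact ⟨hy.1, hz.1⟩

namespace ZGrading

variable {F L : Type*} [Field F] [AddCommGroup L] [Module F L] {A : LieSuperalgebra F L}
  {G : A.ZGrading}

theorem adPow_le_span_homogeneous {μ : L} {m : ZMod 2} (hμ : μ ∈ A.parity m) (k : ℕ) :
    G.adPow μ k ≤ Submodule.span F {x | x ∈ G.adPow μ k ∧ ∃ α, x ∈ A.parity α} := by
  induction k with
  | zero =>
    refine Submodule.span_mono ?_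
    rw [Set.singleton_subset_iff]
    exact ⟨Submodule.mem_span_singleton_self μ, m, hμ⟩
  | succ k ih =>
    rw [adPow_succ]
    refine (Submodule.map₂_le_map₂ (G.comp_eq_span_homogeneous (-1)).le ih).trans ?_
    rw [Submodule.map₂_span_span]
    refine Submodule.span_mono ?_
    rintro _ ⟨a, ⟨α, ha⟩, b, ⟨hb, β, hb'⟩, rfl⟩
    exact ⟨Submodule.apply_mem_map₂ _ ha.1 hb, α + β, A.bracket_mem ha.2 hb'⟩

theorem bracket_mem_adPow_succ {μ : L} {m : ZMod 2} (hμ : μ ∈ A.parity m) {k : ℕ} {x b : L}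
    (hx : x ∈ G.adPow μ k) (hb : b ∈ G.comp (-1)) : A.bracket x b ∈ G.adPow μ (k + 1) := by
  suffices h : Submodule.map₂ A.bracket (G.adPow μ k) (G.comp (-1)) ≤ G.adPow μ (k + 1) from
    h (Submodule.apply_mem_map₂ _ hx hb)
  refine (Submodule.map₂_le_map₂ (adPow_le_span_homogeneous hμ k)
    (G.comp_eq_span_homogeneous (-1)).le).trans ?_
  rw [Submodule.map₂_span_span, Submodule.span_le]
  rintro _ ⟨y, ⟨hy, α, hy'⟩, c, ⟨β, hc⟩, rfl⟩
  rw [SetLike.mem_coe]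
  dsimp only
  rw [A.skew hy' hc.2]
  exact neg_mem (Submodule.smul_mem _ _ (Submodule.apply_mem_map₂ _ hc.1 hy))

namespace IsAdmissible

variable {μ : L} {k : ℕ}

theorem mem_comp (h : G.IsAdmissible (k + 1) μ) : μ ∈ G.comp k := by
  simpa using h.mem

theorem bracket_nested_eq_zero [CharZero F] (h : G.IsAdmissible (k + 1) μ) {m : ZMod 2}
    (hμ : μ ∈ A.parity m) {ι : Type*} [LinearOrder ι] [Fintype ι]
    (hι : Fintype.card ι = 2 * k + 1) {v : ι → L} {π : ι → ZMod 2}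
    (hv : ∀ i, v i ∈ G.comp (-1) ⊓ A.parity (π i)) {s t : Finset ι} (hst : Disjoint s t)
    (hc : s.card + t.card ≤ k) :
    A.bracket (A.nested v μ s) (A.nested v μ t) = 0 := by
  rw [← A.nestedBracket_eq_zero_iff (π := π) (m := m)]
  refine h.transitive.nestedBracket_eq_zero h.mem_comp hμ hst (s ∪ t)ᶜ
    disjoint_compl_left ?_ ?_ hv
  · have h1 := Finset.card_add_card_compl (s ∪ t)
    rw [Finset.card_union_of_disjoint hst] at h1
    omega
  intro w ρ hw
  have hbig : ∀ u : Finset ι, k + 1 < u.card → A.nested w μ u = 0 := fun u hu =>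
    G.eq_zero_of_mem_comp (by omega) (G.nested_mem_comp (fun i => (hw i).1) h.mem_comp u)
  rw [A.nestedBracketSum_compl hst]
  refine Finset.sum_Icc_eq_zero_of_middle_layers hι (fun u => A.nestedBracket w ρ μ m u uᶜ)
    (-koszul F m m) ?_ ?_ ?_ ?_ s t hst hc
  · rw [neg_inj, neg_eq_iff_eq_neg, or_comm]
    exact neg_one_pow_eq_or F _
  -- The factors have degrees k - |u| and |u| - k - 1; outside the two middle layers one of these is
  -- below -1.
  · intro u h1 h2
    rw [A.nestedBracket_eq_zero_iff]
    have := Finset.card_add_card_compl u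
    rcases lt_or_ge (k + 1) u.card with hu | hu
    · rw [hbig u hu, map_zero, LinearMap.zero_apply]
    · rw [hbig uᶜ (by omega), map_zero]
  · intro u
    rw [compl_compl, A.nestedBracket_swap (fun i => (hw i).2) hμ disjoint_compl_right]
  -- For |u| = k this sum is the full expansion of [v_u μ, μ], and v_u μ lies in L_0, which μ
  -- annihilates.
  · intro u hu
    rw [← A.nestedBracketSum_compl (Finset.disjoint_empty_right u)]
    refine G.nestedBracketSum_eq_zero hw hμ (Finset.disjoint_empty_right u) ?_ _
      disjoint_compl_left
    rw [A.nestedBracket_eq_zero_iff, A.nested_empty,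
      A.skew (A.nested_mem_parity (fun i => (hw i).2) hμ u) hμ, h.bracket_zero]
    · simp
    · convert G.nested_mem_comp (fun i => (hw i).1) h.mem_comp u
      rw [hu, sub_self]

theorem bracket_adPow_eq_zero [CharZero F] (h : G.IsAdmissible (k + 1) μ) {p q : ℕ}
    (hpq : p + q ≤ k) {x y : L} (hx : x ∈ G.adPow μ p) (hy : y ∈ G.adPow μ q) :
    A.bracket x y = 0 := by
  obtain ⟨m, hμ⟩ := h.homogeneous
  obtain ⟨s, -, rfl⟩ := Finset.exists_subset_card_eq
    (s := (Finset.univ : Finset (Fin (2 * k + 1)))) (n := p) (by simp; omega)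
  obtain ⟨t, hst, rfl⟩ := Finset.exists_subset_card_eq (s := sᶜ) (n := q)
    (by rw [Finset.card_compl, Fintype.card_fin]; omega)
  have hst : Disjoint s t := (Finset.subset_compl_iff_disjoint_right.1 hst).symm
  suffices hle : Submodule.map₂ A.bracket (G.adPow μ s.card) (G.adPow μ t.card) ≤ ⊥ from
    (Submodule.mem_bot F).1 (hle (Submodule.apply_mem_map₂ _ hx hy))
  refine (Submodule.map₂_le_map₂ (G.adPow_card_le_span_nested μ s)
    (G.adPow_card_le_span_nested μ t)).trans ?_
  rw [Submodule.map₂_span_span, Submodule.span_le]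
  rintro _ ⟨_, ⟨v, π, hv, rfl⟩, _, ⟨w, ρ, hw, rfl⟩, rfl⟩
  rw [SetLike.mem_coe, Submodule.mem_bot,
    A.nested_congr (w := s.piecewise v w) μ fun i hi => (s.piecewise_eq_of_mem v w hi).symm,
    A.nested_congr (v := w) (w := s.piecewise v w) μ fun i hi =>
      (s.piecewise_eq_of_notMem v w (Finset.disjoint_right.1 hst hi)).symm]
  refine h.bracket_nested_eq_zero hμ (Fintype.card_fin _) (π := s.piecewise π ρ)
    (fun i => ?_) hst hpq
  by_cases hi : i ∈ s
  · simpa [hi] using hv i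
  · simpa [hi] using hw i

/-- Induction on q via [z, [b, w]] = [[z, b], w] ± [b, [z, w]]. If p + q drops below k, the last
inner bracket vanishes by `bracket_adPow_eq_zero`. For q = 0 the only nonzero case is p = k + 1,
where x lies in L_{-1}. -/
theorem bracket_adPow_mem [CharZero F] (h : G.IsAdmissible (k + 1) μ) {p q : ℕ}
    (hpq : k ≤ p + q) {x y : L} (hx : x ∈ G.adPow μ p) (hy : y ∈ G.adPow μ q) :
    A.bracket x y ∈ G.adPow μ (p + q - k) := by
  obtain ⟨m, hμ⟩ := h.homogeneous
  induction q generalizing p x y with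
  | zero =>
    have hx' := G.adPow_le_comp h.mem_comp p hx
    rcases hpq.eq_or_lt with hp | hp
    · rw [h.bracket_adPow_eq_zero hp.ge hx hy]
      exact zero_mem _
    · rcases eq_or_lt_of_le (Nat.succ_le_of_lt hp) with hp | hp
      · rw [show (p + 0 - k) = 0 + 1 by omega, adPow_succ]
        refine Submodule.apply_mem_map₂ _ ?_ hy
        convert hx'
        omega
      · rw [G.eq_zero_of_mem_comp (by omega) hx', map_zero, LinearMap.zero_apply]
        exact zero_mem _
  | succ q ih =>
    suffices hle : Submodule.map₂ A.bracket (G.adPow μ p) (G.adPow μ (q + 1)) ≤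
        G.adPow μ (p + (q + 1) - k) from hle (Submodule.apply_mem_map₂ _ hx hy)
    refine (Submodule.map₂_le_map₂ (adPow_le_span_homogeneous hμ p)
      (Submodule.map₂_le_map₂_left (G.comp_eq_span_homogeneous (-1)).le)).trans ?_
    rw [← Submodule.span_eq (G.adPow μ q), Submodule.map₂_span_span, Submodule.map₂_span_span,
      Submodule.span_le]
    rintro _ ⟨z, ⟨hz, α, hz'⟩, _, ⟨b, ⟨β, hb⟩, w, hw, rfl⟩, rfl⟩
    rw [SetLike.mem_coe]
    dsimp only
    rw [A.jacobi w hz' hb.2]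
    refine add_mem ?_ (Submodule.smul_mem _ _ ?_)
    · convert ih (by omega) (bracket_mem_adPow_succ hμ hz hb.1) hw using 2
      omega
    · rcases le_or_gt k (p + q) with hk | hk
      · rw [show p + (q + 1) - k = p + q - k + 1 by omega, adPow_succ]
        exact Submodule.apply_mem_map₂ _ hb.1 (ih hk hz hw)
      · rw [h.bracket_adPow_eq_zero hk.le hz hw, map_zero]
        exact zero_mem _

end IsAdmissible

/-! ### The graded subsuperalgebra generated by L_{-1} and μ -/

variable (G) in
/-- The homogeneous components of the graded subspace `L_{-1} + ∑_p (ad L_{-1})^p μ`, where `μ` is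
of degree `k`. -/
def generatedComp (k : ℕ) (μ : L) (j : ℤ) : Submodule F L :=
  if j = -1 then G.comp (-1) else if 0 ≤ j ∧ j ≤ k then G.adPow μ (k - j).toNat else ⊥

theorem mem_generatedComp {k : ℕ} {μ x : L} {j : ℤ} (hx : x ∈ G.generatedComp k μ j) :
    x = 0 ∨ (j = -1 ∧ x ∈ G.comp (-1)) ∨ ∃ p : ℕ, p ≤ k ∧ j = k - p ∧ x ∈ G.adPow μ p := by
  rw [generatedComp] at hx
  split_ifs at hx with h1 h2
  · exact Or.inr (Or.inl ⟨h1, hx⟩)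
  · exact Or.inr (Or.inr ⟨_, by omega, by omega, hx⟩)
  · exact Or.inl hx

theorem adPow_le_generatedComp {k : ℕ} {μ : L} (hμ : μ ∈ G.comp k) {p : ℕ} (hp : p ≤ k + 1) :
    G.adPow μ p ≤ G.generatedComp k μ (k - p) := by
  rw [generatedComp]
  split_ifs with h1 h2
  · rw [← h1]
    exact G.adPow_le_comp hμ p
  · simp
  · omega

theorem generatedComp_le_span_homogeneous {μ : L} {m : ZMod 2} (hμ : μ ∈ A.parity m) (k : ℕ)
    (j : ℤ) : G.generatedComp k μ j ≤
      Submodule.span F {x | x ∈ G.generatedComp k μ j ∧ ∃ α, x ∈ A.parity α} := by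
  rw [generatedComp]
  split_ifs
  · exact (G.comp_eq_span_homogeneous (-1)).le.trans
      (Submodule.span_mono fun x ⟨α, hx⟩ => ⟨hx.1, α, hx.2⟩)
  · exact adPow_le_span_homogeneous hμ _
  · exact bot_le

theorem IsAdmissible.bracket_mem_generatedComp [CharZero F] {μ : L} {k : ℕ}
    (h : G.IsAdmissible (k + 1) μ) {i j : ℤ} {x y : L} (hx : x ∈ G.generatedComp k μ i)
    (hy : y ∈ G.generatedComp k μ j) : A.bracket x y ∈ G.generatedComp k μ (i + j) := by
  obtain ⟨m, hμ⟩ := h.homogeneous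
  rcases mem_generatedComp hx with rfl | ⟨rfl, hx'⟩ | ⟨p, hp, rfl, hx'⟩
  · rw [map_zero, LinearMap.zero_apply]
    exact zero_mem _
  · rcases mem_generatedComp hy with rfl | ⟨rfl, hy'⟩ | ⟨q, hq, rfl, hy'⟩
    · rw [map_zero]
      exact zero_mem _
    · rw [G.bracket_eq_zero_of_mem_comp_neg_one hx' hy']
      exact zero_mem _
    · convert adPow_le_generatedComp h.mem_comp (by omega : q + 1 ≤ k + 1)
        (Submodule.apply_mem_map₂ A.bracket hx' hy') using 2
      push_cast
      ring
  · rcases mem_generatedComp hy with rfl | ⟨rfl, hy'⟩ | ⟨q, hq, rfl, hy'⟩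
    · rw [map_zero]
      exact zero_mem _
    · convert adPow_le_generatedComp h.mem_comp (by omega : p + 1 ≤ k + 1)
        (bracket_mem_adPow_succ hμ hx' hy') using 2
      push_cast
      ring
    · rcases le_or_gt k (p + q) with hk | hk
      · convert adPow_le_generatedComp h.mem_comp (by omega : p + q - k ≤ k + 1)
          (h.bracket_adPow_mem hk hx' hy') using 2
        omega
      · rw [h.bracket_adPow_eq_zero hk.le hx' hy']
        exact zero_mem _

variable (G) in
/-- The product of a family of subspaces of the homogeneous components. -/
def productSubmodule (N : ℤ → Submodule F L) : Submodule F L :=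
  ⨅ j, (N j).comap ((G.comp j).subtype ∘ₗ G.proj j)

theorem mem_productSubmodule {N : ℤ → Submodule F L} {x : L} :
    x ∈ G.productSubmodule N ↔ ∀ j, (G.proj j x : L) ∈ N j := by
  simp [productSubmodule]

theorem mem_productSubmodule_of_mem {N : ℤ → Submodule F L} {j : ℤ} {x : L} (hx : x ∈ G.comp j)
    (hN : x ∈ N j) : x ∈ G.productSubmodule N := by
  rw [mem_productSubmodule]
  intro i
  rw [G.proj_of_mem j i x hx]
  split_ifs with h
  · exact h ▸ hN
  · exact zero_mem _

theorem isGradedSubsuperalgebra_productSubmodule {N : ℤ → Submodule F L}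
    (hN : ∀ j, N j ≤ Submodule.span F {x | x ∈ N j ∧ ∃ α, x ∈ A.parity α})
    (hb : ∀ i j, ∀ x ∈ N i, ∀ y ∈ N j, A.bracket x y ∈ N (i + j)) :
    G.IsGradedSubsuperalgebra (G.productSubmodule N) := by
  refine ⟨⟨le_antisymm ?_ (sup_le inf_le_left inf_le_left), ?_⟩, fun x => ⟨fun hx j => ?_, ?_⟩⟩
  · intro x hx
    rw [mem_productSubmodule] at hx
    obtain ⟨a, ha, b, hb, rfl⟩ := Submodule.mem_sup.1
      (A.isCompl_parity.sup_eq_top ▸ Submodule.mem_top : x ∈ A.parity 0 ⊔ A.parity 1)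
    have key : ∀ j, (G.proj j a : L) ∈ N j ∧ (G.proj j b : L) ∈ N j := fun j =>
      A.mem_of_add_mem (hN j) (G.proj_parity 0 a ha j) (G.proj_parity 1 b hb j)
        (by simpa using hx j)
    exact Submodule.add_mem_sup ⟨mem_productSubmodule.2 fun j => (key j).1, ha⟩
      ⟨mem_productSubmodule.2 fun j => (key j).2, hb⟩
  · intro x hx y hy
    rw [mem_productSubmodule] at hx hy ⊢
    intro j
    rw [G.proj_bracket]
    refine Submodule.sum_mem _ fun i _ => ?_
    simpa using hb _ _ _ (hx i) _ (hy (j - i))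
  · exact mem_productSubmodule_of_mem (Submodule.coe_mem _) (mem_productSubmodule.1 hx j)
  · intro hx
    rw [mem_productSubmodule]
    intro j
    have := mem_productSubmodule.1 (hx j) j
    rwa [G.proj_self (Submodule.coe_mem _)] at this

theorem IsAdmissible.comp_le_generatedComp [CharZero F] {μ : L} {k : ℕ}
    (h : G.IsAdmissible (k + 1) μ) (j : ℤ) : G.comp j ≤ G.generatedComp k μ j := by
  obtain ⟨m, hμ⟩ := h.homogeneous
  have htop := h.generated (G.productSubmodule (G.generatedComp k μ))
    (isGradedSubsuperalgebra_productSubmodule (generatedComp_le_span_homogeneous hμ k)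
      fun i j x hx y hy => h.bracket_mem_generatedComp hx hy) (by
        rintro x (hx | rfl)
        · exact mem_productSubmodule_of_mem hx (by simpa [generatedComp] using hx)
        · refine mem_productSubmodule_of_mem h.mem_comp ?_
          have := adPow_le_generatedComp h.mem_comp (Nat.zero_le _)
            (Submodule.mem_span_singleton_self x)
          simpa using this)
  intro x hx
  have := mem_productSubmodule.1 (htop ▸ Submodule.mem_top :
    x ∈ G.productSubmodule (G.generatedComp k μ)) j
  rwa [G.proj_self hx] at this

theorem IsAdmissible.comp_eq_adPow [CharZero F] {μ : L} {k : ℕ}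
    (h : G.IsAdmissible (k + 1) μ) {j : ℕ} (hj : j ≤ k) :
    G.comp j = G.adPow μ (k - j) := by
  apply le_antisymm
  · convert h.comp_le_generatedComp j using 1
    rw [generatedComp, if_neg (by omega), if_pos (by omega)]
    congr 1
    omega
  · convert G.adPow_le_comp h.mem_comp (k - j) using 2
    omega

theorem IsAdmissible.comp_eq_bot_of_lt [CharZero F] {μ : L} {k : ℕ}
    (h : G.IsAdmissible (k + 1) μ) {j : ℤ} (hj : (k : ℤ) < j) : G.comp j = ⊥ := by
  rw [eq_bot_iff]
  convert h.comp_le_generatedComp j using 1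
  rw [generatedComp, if_neg (by omega), if_neg (by omega)]

/-! ### The direct sum decomposition and the ideal S -/

theorem iSupIndep_comp (G : A.ZGrading) : iSupIndep G.comp := by
  intro i
  rw [Submodule.disjoint_def]
  intro x hx hx'
  have hle : (⨆ (j : ℤ) (_ : j ≠ i), G.comp j) ≤ LinearMap.ker (G.proj i) :=
    iSup₂_le fun j hj y hy => Subtype.ext (G.proj_of_ne hy hj.symm)
  have h0 : G.proj i x = 0 := hle hx'
  rw [← G.proj_self hx, h0, Submodule.coe_zero]

theorem sum_proj_eq {d : ℤ} {x : L} (h : ∀ j, d < j → (G.proj j x : L) = 0) :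
    ∑ j ∈ Finset.Icc (-1) d, (G.proj j x : L) = x := by
  refine G.ext_proj fun i => ?_
  rw [map_sum, Submodule.coe_sum]
  by_cases hi : i ∈ Finset.Icc (-1) d
  · rw [Finset.sum_eq_single_of_mem i hi fun j _ hj =>
      G.proj_of_ne (Submodule.coe_mem _) hj.symm, G.proj_self (Submodule.coe_mem _)]
  · rw [Finset.sum_eq_zero fun j hj =>
      G.proj_of_ne (Submodule.coe_mem _) fun hij => hi (by rwa [hij])]
    rw [Finset.mem_Icc, not_and_or, not_le, not_le] at hi
    rcases hi with hi | hi
    · rw [G.eq_zero_of_mem_comp hi (Submodule.coe_mem _)]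
    · rw [h i hi]

theorem mem_iSup_comp {d : ℤ} {x : L} (h : ∀ j, d < j → (G.proj j x : L) = 0) :
    x ∈ ⨆ j ∈ Set.Icc (-1 : ℤ) d, G.comp j := by
  rw [← sum_proj_eq h]
  exact Submodule.sum_mem _ fun j hj =>
    Submodule.mem_iSup_of_mem j (Submodule.mem_iSup_of_mem (Finset.mem_Icc.1 hj)
      (Submodule.coe_mem _))

/-- A pair of degrees i and k - i either has one of them above k, where L vanishes, or corresponds
to exponents p + q = k, the boundary case of `bracket_adPow_eq_zero`. -/
theorem IsAdmissible.proj_bracket_eq_zero [CharZero F] {μ : L} {k : ℕ}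
    (h : G.IsAdmissible (k + 1) μ) (x y : L) : (G.proj k (A.bracket x y) : L) = 0 := by
  have hzero : ∀ (z : L) (j : ℤ), (k : ℤ) < j → (G.proj j z : L) = 0 := fun z j hj => by
    simpa [h.comp_eq_bot_of_lt hj] using Submodule.coe_mem (G.proj j z)
  rw [G.proj_bracket]
  refine Finset.sum_eq_zero fun i hi => ?_
  rw [Finset.mem_Icc] at hi
  rcases lt_or_ge i 0 with hi0 | hi0
  · rw [hzero y (k - i) (by omega), map_zero]
  rcases lt_or_ge (k : ℤ) i with hik | hik
  · rw [hzero x i hik, map_zero, LinearMap.zero_apply]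
  obtain ⟨j, rfl⟩ := Int.eq_ofNat_of_zero_le hi0
  have hj : j ≤ k := by omega
  have e : (k : ℤ) - j = ((k - j : ℕ) : ℤ) := by omega
  refine h.bracket_adPow_eq_zero (p := k - j) (q := k - (k - j)) (by omega) ?_ ?_
  · rw [← h.comp_eq_adPow hj]
    exact Submodule.coe_mem _
  · rw [← h.comp_eq_adPow (by omega), ← e]
    exact Submodule.coe_mem _

end ZGrading

end LieSuperalgebra

theorem theorem0p2 {F L : Type*} [Field F] [CharZero F] [AddCommGroup L] [Module F L]
    (A : LieSuperalgebra F L) (G : A.ZGrading) (n : ℕ) (hn : 2 ≤ n) (μ : L)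
    (h : G.IsAdmissible n μ) :
    DirectSum.IsInternal (fun j : Set.Icc (-1 : ℤ) ((n : ℤ) - 1) => G.comp j) ∧
    G.comp ((n : ℤ) - 1) = Submodule.span F {μ} ∧
    A.IsIdeal (⨆ j ∈ Set.Icc (-1 : ℤ) ((n : ℤ) - 2), G.comp j) ∧
    ∀ j : ℕ, j ≤ n - 1 → G.comp (j : ℤ) = G.adPow μ (n - j - 1) := by
  obtain ⟨k, rfl⟩ : ∃ k, n = k + 1 := ⟨n - 1, by omega⟩
  have e1 : ((k + 1 : ℕ) : ℤ) - 1 = k := by omega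
  have e2 : ((k + 1 : ℕ) : ℤ) - 2 = k - 1 := by omega
  rw [e1, e2]
  have hzero : ∀ (z : L) (j : ℤ), (k : ℤ) < j → (G.proj j z : L) = 0 := fun z j hj => by
    simpa [h.comp_eq_bot_of_lt hj] using Submodule.coe_mem (G.proj j z)
  refine ⟨?_, ?_, ⟨le_antisymm ?_ (sup_le inf_le_left inf_le_left), ?_⟩, ?_⟩
  · rw [DirectSum.isInternal_submodule_iff_iSupIndep_and_iSup_eq_top]
    refine ⟨G.iSupIndep_comp.comp Subtype.val_injective, eq_top_iff.2 fun x _ => ?_⟩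
    rw [iSup_subtype]
    exact LieSuperalgebra.ZGrading.mem_iSup_comp (hzero x)
  · rw [h.comp_eq_adPow le_rfl, Nat.sub_self, LieSuperalgebra.ZGrading.adPow]
  · refine iSup₂_le fun j hj x hx => ?_
    have hle : G.comp j ≤ ⨆ j ∈ Set.Icc (-1 : ℤ) (k - 1), G.comp j :=
      le_iSup₂_of_le j hj le_rfl
    obtain ⟨a, ha, b, hb, rfl⟩ := G.exists_parity_add hx
    exact Submodule.add_mem_sup ⟨hle ha.1, ha.2⟩ ⟨hle hb.1, hb.2⟩
  -- All of [L, L] lies in S: a bracket has no component in degree k, and none exist above it.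
  · intro x y _
    refine LieSuperalgebra.ZGrading.mem_iSup_comp fun j hj => ?_
    rcases (Int.le_of_sub_one_lt hj).eq_or_lt with rfl | hj
    · exact h.proj_bracket_eq_zero x y
    · exact hzero _ j hj
  · intro j hj
    rw [h.comp_eq_adPow (by omega)]
    congr 1
    omega
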